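/- Let $K=\mathbb R$ or $K=\mathbb C$ and let $n\ge 2$. On the set of $p=(p_1,\dots,p_n)\in K^n$ with all $p_i\neq 0$ consider the metric $g$ whose contravariant components in the coordinates $p$ are $$g^{ij}(p)=\frac{1-\delta^{ij}}{p_ip_j},\qquad i,j=1,\dots,n,$$ and let $u_i=\sum_{1\le l_1<\dots<l_i\le n}p_{l_1}^2\cdots p_{l_i}^2$ $(i=1,\dots,n)$ be the elementary symmetric polynomials in $p_1^2,\dots,p_n^2$. Use $(u_1,\dots,u_n)$ as local coordinates, i.e. on open sets $U\subseteq K^n$ of values of $u$ on which the map $p\mapsto u(p)$ has a differentiable local inverse $\psi$ (so $u(\psi(x))=x$ for $x\in U$). In these coordinates $g$ has contravariant components $g^{ij}(u)=\sum_{k,l}g^{kl}(p)\frac{\partial u_i}{\partial p_k}\frac{\partial u_j}{\partial p_l}$ at $p=\psi(u)$; let $(g_{ij}(u))$ be the inverse matrix, $$\Gamma^k_{ij}=\frac12\sum_{m}g^{mk}\left(\frac{\partial g_{im}}{\partial u_j}+\frac{\partial g_{jm}}{\partial u_i}-\frac{\partial g_{ij}}{\partial u_m}\right),\qquad \Gamma^{ij}_k=-\sum_{s}g^{is}\,\Gamma^j_{sk}$$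 the Christoffel symbols and the contravariant Christoffel symbols of the Levi-Civita connection of $g$ in the coordinates $u$. Then there are polynomials $P^{ij}_k\in K[u_1,\dots,u_n]$, $i,j,k=1,\dots,n$, depending only on $K$ and $n$, such that $\Gamma^{ij}_k=P^{ij}_k(u_1,\dots,u_n)$ for every such local inverse. Moreover, giving $u_a$ the degree $2a$ (its degree as a polynomial in $p$), the degree of every $P^{ij}_k$ is less than $4n-4$, and every $P^{ij}_k$ has degree at most $1$ in the variable $u_{n-1}$. -/

import Mathlib

noncomputable section

namespace OrbitB

variable {𝕜 : Type*} [RCLike 𝕜] {n : ℕ}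

/-- The partial derivative `∂f/∂x_k` at `x` of a function `f` of `n` variables. -/
def pd (k : Fin n) (f : (Fin n → 𝕜) → 𝕜) (x : Fin n → 𝕜) : 𝕜 :=
  fderiv 𝕜 f x (Pi.single k 1)

/-- Christoffel symbols `Γ^k_{ij}` at `x` of the Levi-Civita connection of the metric whose
contravariant components (cometric) in the coordinates `x` are `h`; the covariant components
are those of the inverse matrix. -/
def christoffel (h : (Fin n → 𝕜) → Matrix (Fin n) (Fin n) 𝕜) (x : Fin n → 𝕜)
    (k i j : Fin n) : 𝕜 :=
  (1 / 2) * ∑ m, h x m k *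
    (pd j (fun y => (h y)⁻¹ i m) x + pd i (fun y => (h y)⁻¹ j m) x
      - pd m (fun y => (h y)⁻¹ i j) x)

/-- Contravariant Christoffel symbols `Γ^{ij}_k = - ∑ₛ h^{is} Γ^j_{sk}`. -/
def contraChristoffel (h : (Fin n → 𝕜) → Matrix (Fin n) (Fin n) 𝕜) (x : Fin n → 𝕜)
    (i j k : Fin n) : 𝕜 :=
  -∑ s, h x i s * christoffel h x j s k

/-- The cometric `g^{ij}(p) = (1 - δ^{ij}) / (p_i p_j)`. -/
def cometric (p : Fin n → 𝕜) : Matrix (Fin n) (Fin n) 𝕜 :=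
  Matrix.of fun i j => (if i = j then 0 else 1) / (p i * p j)

/-- The basic invariants of `B_n`: with the index `i : Fin n` starting from `0`, `basicInv p i`
is `u_{i+1}(p)`, the elementary symmetric polynomial of degree `i + 1` in `p_1², …, p_n²`. -/
def basicInv (p : Fin n → 𝕜) (i : Fin n) : 𝕜 :=
  ∑ s ∈ Finset.powersetCard ((i : ℕ) + 1) (Finset.univ : Finset (Fin n)), ∏ l ∈ s, p l ^ 2

/-- `u_1, …, u_n` as local coordinates: `ψ` is a (differentiable) local inverse, on the open
set `U` of the space of values of `u`, of the map `p ↦ (u_1(p), …, u_n(p))`. -/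
structure IsLocalInverse (U : Set (Fin n → 𝕜)) (ψ : (Fin n → 𝕜) → (Fin n → 𝕜)) : Prop where
  isOpen : IsOpen U
  differentiableOn : DifferentiableOn 𝕜 ψ U
  right_inv : ∀ x ∈ U, basicInv (ψ x) = x

/-- The components of the cometric in the coordinates `u`, at the point `p = ψ x` with
coordinates `u(p) = x`: `g^{ij}(u) = ∑ g^{kl}(p) (∂u_i/∂p_k) (∂u_j/∂p_l)`. -/
def cometricInU (ψ : (Fin n → 𝕜) → (Fin n → 𝕜)) (x : Fin n → 𝕜) :
    Matrix (Fin n) (Fin n) 𝕜 :=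
  Matrix.of fun i j => ∑ k, ∑ l, cometric (ψ x) k l *
    pd k (fun p => basicInv p i) (ψ x) * pd l (fun p => basicInv p j) (ψ x)

end OrbitB

end

open Finset Filter Topology

namespace OrbitB

/-! In the coordinates q_l = p_l² the cometric is the constant matrix 4(1 - δ^{ab}), so q is a flat
coordinate system and Γ^{ij}_k = Σ_c (Σ_{a,b} ∂_a u_i C^{ab} ∂_c∂_b u_j) ∂q_c/∂u_k
(`contraChristoffel_of_flat`, `contraChristoffel_cometricInU`). If the bracket is Σ_k P_k(u) ∂_c
u_k, then Γ^{ij}_k = P_k, because the two Jacobians are inverse to each other.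

Such P_k come from exchange identities for elementary symmetric polynomials, which move degree from
one factor of a product to the other until the last factor is 1 (`contraction_mem_combination`).
Every coefficient produced is a scalar multiple of a single e_m(q), with m < 2n - 2. As e_m is 1, a
coordinate u_m or 0, both degree bounds follow. -/

/-- The elementary symmetric polynomial of degree `m` in the variables `q l`, `l ∈ S`. -/
def esym {R : Type*} [CommRing R] {ι : Type*} (S : Finset ι) (m : ℕ) (q : ι → R) : R :=
  ∑ s ∈ powersetCard m S, ∏ l ∈ s, q l

/-! ### Identities between elementary symmetric polynomials with variables removed. -/

section Algebra

variable {R : Type*} [CommRing R] {ι : Type*}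

@[simp] theorem esym_zero (S : Finset ι) (q : ι → R) : esym S 0 q = 1 := by
  simp [esym]

theorem esym_eq_zero {S : Finset ι} {m : ℕ} (h : #S < m) (q : ι → R) : esym S m q = 0 := by
  simp [esym, powersetCard_eq_empty.2 h]

theorem esym_congr {S : Finset ι} {m : ℕ} {q q' : ι → R} (h : ∀ l ∈ S, q l = q' l) :
    esym S m q = esym S m q' :=
  sum_congr rfl fun _ hs => prod_congr rfl fun _ hl => h _ ((mem_powersetCard.1 hs).1 hl)

variable [DecidableEq ι]

theorem esym_succ {S : Finset ι} {a : ι} (ha : a ∈ S) (m : ℕ) (q : ι → R) :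
    esym S (m + 1) q = esym (S.erase a) (m + 1) q + q a * esym (S.erase a) m q := by
  conv_lhs => rw [← insert_erase ha]
  have hn : ∀ s ∈ powersetCard m (S.erase a), a ∉ s := fun s hs h =>
    notMem_erase a S ((mem_powersetCard.1 hs).1 h)
  rw [esym, powersetCard_succ_insert (notMem_erase a S), sum_union, sum_image, esym, esym,
    mul_sum]
  · congr 1
    exact sum_congr rfl fun s hs => prod_insert (hn s hs)
  · intro s hs t ht h
    rw [← erase_insert (hn s hs), ← erase_insert (hn t ht), h]
  · rw [disjoint_left]
    intro s hs hs'
    obtain ⟨t, -, rfl⟩ := mem_image.1 hs'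
    exact notMem_erase a S ((mem_powersetCard.1 hs).1 (mem_insert_self a t))

/-- Double counting: an `m`-subset of `S` is avoided by exactly `#S - m` elements `a`. -/
theorem sum_esym_erase (S : Finset ι) (m : ℕ) (q : ι → R) :
    ∑ a ∈ S, esym (S.erase a) m q = ((#S : R) - m) * esym S m q := by
  have h : ∀ a, esym (S.erase a) m q =
      ∑ s ∈ powersetCard m S, if a ∉ s then ∏ l ∈ s, q l else 0 := by
    intro a
    rw [← sum_filter, esym]
    refine sum_congr ?_ fun _ _ => rfl
    ext s
    simp only [mem_powersetCard, mem_filter, subset_erase]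
    tauto
  simp only [h]
  rw [sum_comm, esym, mul_sum]
  refine sum_congr rfl fun s hs => ?_
  obtain ⟨hs', rfl⟩ := mem_powersetCard.1 hs
  rw [← sum_filter, sum_const, filter_notMem_eq_sdiff, card_sdiff_of_subset hs', nsmul_eq_mul,
    Nat.cast_sub (card_le_card hs')]

/-- Splitting off the variable `q c` on the right, the terms containing it cancel. This trades
degree `(i, j + 1)` for `(i + 1, j)`, up to products with a full symmetric polynomial. -/
theorem esym_erase_mul_succ_sub {S : Finset ι} {c : ι} (hc : c ∈ S) (i j : ℕ) (q : ι → R) :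
    esym (S.erase c) i q * esym (S.erase c) (j + 1) q =
      esym (S.erase c) (i + 1) q * esym (S.erase c) j q + esym S (j + 1) q * esym (S.erase c) i q
        - esym S (i + 1) q * esym (S.erase c) j q := by
  rw [esym_succ hc i, esym_succ hc j]
  ring

theorem sum_esym_erase_mul_zero {S : Finset ι} {c : ι} (hc : c ∈ S) (i : ℕ) (q : ι → R) :
    ∑ a ∈ S.erase c, esym (S.erase a) i q =
      ((#S : R) - i) * esym S i q - esym (S.erase c) i q := by
  rw [← sum_esym_erase, ← add_sum_erase S _ hc]
  ring

/-- The same exchange, now splitting off `q a` from `S` and from `S.erase c`, and then summing over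
`a`; the error terms are evaluated by `sum_esym_erase`. -/
theorem sum_esym_erase_mul_succ {S : Finset ι} {c : ι} (hc : c ∈ S) (i j : ℕ) (q : ι → R) :
    ∑ a ∈ S.erase c, esym (S.erase a) i q * esym ((S.erase c).erase a) (j + 1) q =
      ∑ a ∈ S.erase c, esym (S.erase a) (i + 1) q * esym ((S.erase c).erase a) j q
        + (((#S : R) - i) * esym S i q - esym (S.erase c) i q) * esym (S.erase c) (j + 1) q
        - esym S (i + 1) q * (((#S : R) - 1 - j) * esym (S.erase c) j q) := by
  have h1 : (#S : R) - 1 = #(S.erase c) := by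
    rw [card_erase_of_mem hc, Nat.cast_sub (card_pos.2 ⟨c, hc⟩), Nat.cast_one]
  rw [← sum_esym_erase_mul_zero hc, h1, ← sum_esym_erase, sum_mul, mul_sum, ← sum_add_distrib,
    ← sum_sub_distrib]
  refine sum_congr rfl fun a ha => ?_
  rw [esym_succ ha j, esym_succ (mem_of_mem_erase ha) i]
  ring

end Algebra

/-! ### The Hessian contraction as a low-degree combination of the differentials du_k. -/

section Coefficients

variable (𝕜 : Type*) [RCLike 𝕜] (n : ℕ)

/-- The polynomials of weighted degree less than `4 n - 4`, of degree at most one in each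
variable. -/
noncomputable def lowDegree : Submodule 𝕜 (MvPolynomial (Fin n) 𝕜) :=
  MvPolynomial.restrictSupport 𝕜
    {d | Finsupp.weight (fun a : Fin n => 2 * ((a : ℕ) + 1)) d < 4 * n - 4 ∧ ∀ a, d a ≤ 1}

/-- The families of functions (in the variables `q`, indexed by `c`) that are combinations of the
differentials of the elementary symmetric polynomials, with coefficients that are
polynomials of low degree in the elementary symmetric polynomials. -/
def combination : Submodule 𝕜 ((Fin n → 𝕜) → Fin n → 𝕜) where
  carrier := {F | ∃ P : Fin n → MvPolynomial (Fin n) 𝕜, (∀ k, P k ∈ lowDegree 𝕜 n) ∧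
    ∀ q c, F q c = ∑ k : Fin n, MvPolynomial.eval (fun i : Fin n => esym univ ((i : ℕ) + 1) q) (P k)
      * esym (univ.erase c) k q}
  zero_mem' := ⟨0, fun _ => Submodule.zero_mem _, by simp⟩
  add_mem' := by
    rintro F G ⟨P, hP, hF⟩ ⟨Q, hQ, hG⟩
    refine ⟨P + Q, fun k => Submodule.add_mem _ (hP k) (hQ k), fun q c => ?_⟩
    simp [hF, hG, add_mul, sum_add_distrib]
  smul_mem' := by
    rintro r F ⟨P, hP, hF⟩
    refine ⟨r • P, fun k => Submodule.smul_mem _ r (hP k), fun q c => ?_⟩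
    simp [hF, mul_sum, MvPolynomial.smul_eval, mul_assoc]

variable {n}

theorem exists_lowDegree_eval (m : ℕ) (hm : m < 2 * n - 2) :
    ∃ P ∈ lowDegree 𝕜 n, ∀ q : Fin n → 𝕜,
      MvPolynomial.eval (fun i : Fin n => esym univ ((i : ℕ) + 1) q) P = esym univ m q := by
  rcases m with _ | m
  · refine ⟨1, ?_, by simp⟩
    rw [lowDegree, MvPolynomial.mem_restrictSupport_iff]
    intro d hd
    have : d = 0 := by
      have := MvPolynomial.support_monomial_subset (R := 𝕜) (s := 0) (a := 1) hd
      simpa using this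
    subst this
    simp
    omega
  · by_cases h : m < n
    · refine ⟨MvPolynomial.X ⟨m, h⟩, ?_, by simp⟩
      rw [lowDegree, MvPolynomial.mem_restrictSupport_iff]
      intro d hd
      have : d = Finsupp.single ⟨m, h⟩ 1 := by
        simpa [MvPolynomial.support_X] using hd
      subst this
      refine ⟨by simp [Finsupp.weight_single]; omega, fun a => ?_⟩
      rw [Finsupp.single_apply]
      split_ifs <;> simp
    · refine ⟨0, Submodule.zero_mem _, fun q => ?_⟩
      rw [map_zero, esym_eq_zero]
      simp; omega

theorem esym_mul_mem_combination (m k : ℕ) (hm : m < 2 * n - 2) :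
    (fun q c => esym univ m q * esym (univ.erase c) k q) ∈ combination 𝕜 n := by
  obtain ⟨P, hP, h⟩ := exists_lowDegree_eval 𝕜 m hm
  by_cases hk : k < n
  · refine ⟨Pi.single ⟨k, hk⟩ P, fun l => ?_, fun q c => ?_⟩
    · by_cases hl : l = ⟨k, hk⟩
      · subst hl; simpa using hP
      · simp [Pi.single_eq_of_ne hl]
    · rw [sum_eq_single ⟨k, hk⟩]
      · simp [h]
      · intro l _ hl
        simp [Pi.single_eq_of_ne hl]
      · simp
  -- Only `n - 1` variables remain after removing `c`, so the second factor vanishes for `k ≥ n`.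
  · convert Submodule.zero_mem (combination 𝕜 n) using 1
    ext q c
    rw [esym_eq_zero (S := univ.erase c)]
    · simp
    · rw [card_erase_of_mem (mem_univ c)]; simp; have := c.2; omega

theorem esym_erase_mul_mem_combination (i j : ℕ) (h : i + j < 2 * n - 2) :
    (fun q c => esym (univ.erase c) i q * esym (univ.erase c) j q) ∈ combination 𝕜 n := by
  induction j generalizing i with
  | zero => simpa using esym_mul_mem_combination 𝕜 0 i (by omega)
  | succ j ih =>
    refine (congrArg (· ∈ combination 𝕜 n) ?_).mpr (Submodule.sub_mem _ (Submodule.add_mem _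
      (ih (i + 1) (by omega)) (esym_mul_mem_combination 𝕜 (j + 1) i (by omega)))
      (esym_mul_mem_combination 𝕜 (i + 1) j (by omega)))
    ext q c
    simp only [esym_erase_mul_succ_sub (mem_univ c) i j q, Pi.sub_apply, Pi.add_apply]

theorem sum_esym_erase_mul_mem_combination (i j : ℕ) (h : i + j < 2 * n - 2) :
    (fun q c => ∑ a ∈ univ.erase c, esym (univ.erase a) i q * esym ((univ.erase c).erase a) j q)
      ∈ combination 𝕜 n := by
  induction j generalizing i with
  | zero =>
    refine (congrArg (· ∈ combination 𝕜 n) ?_).mpr (Submodule.sub_mem _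
      (Submodule.smul_mem _ ((n : 𝕜) - i) (esym_mul_mem_combination 𝕜 i 0 (by omega)))
      (esym_mul_mem_combination 𝕜 0 i (by omega)))
    ext q c
    simp [sum_esym_erase_mul_zero (mem_univ c)]
  | succ j ih =>
    refine (congrArg (· ∈ combination 𝕜 n) ?_).mpr (Submodule.sub_mem _ (Submodule.add_mem _
      (ih (i + 1) (by omega)) (Submodule.sub_mem _ (Submodule.smul_mem _ ((n : 𝕜) - i)
        (esym_mul_mem_combination 𝕜 i (j + 1) (by omega)))
        (esym_erase_mul_mem_combination 𝕜 i (j + 1) (by omega))))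
      (Submodule.smul_mem _ ((n : 𝕜) - 1 - j) (esym_mul_mem_combination 𝕜 (i + 1) j (by omega))))
    ext q c
    simp only [sum_esym_erase_mul_succ (mem_univ c) i j q, Pi.sub_apply, Pi.add_apply,
      Pi.smul_apply, smul_eq_mul, card_univ, Fintype.card_fin]
    ring

/-- The second partial derivative `∂²e_{j+1}/∂q_c∂q_b` of an elementary symmetric polynomial. -/
def esymHess (j : ℕ) (c b : Fin n) (q : Fin n → 𝕜) : 𝕜 :=
  -- Each e_{j+1} is affine in every variable, so the diagonal vanishes; `j = 0` is separated
  -- because `j - 1` would truncate.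
  if b = c ∨ j = 0 then 0 else esym ((univ.erase c).erase b) (j - 1) q

theorem esymHess_comm (j : ℕ) (c b : Fin n) (q : Fin n → 𝕜) :
    esymHess 𝕜 j c b q = esymHess 𝕜 j b c q := by
  simp only [esymHess, erase_right_comm, eq_comm]

variable (n) in
/-- The contravariant components of the metric in the coordinates `p_i²`. -/
def flatCometric : Matrix (Fin n) (Fin n) 𝕜 :=
  Matrix.of fun a b => if a = b then 0 else 4

theorem contraction_mem_combination (hn : 2 ≤ n) (i j : Fin n) :
    (fun q c => ∑ a, ∑ b, esym (univ.erase a) i q * flatCometric 𝕜 n a b * esymHess 𝕜 j c b q)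
      ∈ combination 𝕜 n := by
  obtain ⟨j, hj⟩ := j
  rcases j with _ | j
  · convert Submodule.zero_mem (combination 𝕜 n) using 1
    ext q c
    simp [esymHess]
  -- Since C = 4(J - I) with J the all-ones matrix, the contraction is 4 times a product of two full
  -- sums minus the diagonal sum. Here i ≤ n - 1 and j + 1 ≤ n - 1, whence i + j < 2n - 2.
  · refine (congrArg (· ∈ combination 𝕜 n) ?_).mpr (Submodule.smul_mem _ 4 (Submodule.sub_mem _
      (Submodule.smul_mem _ (((n : 𝕜) - i) * ((n : 𝕜) - 1 - j))
        (esym_mul_mem_combination 𝕜 i j (by omega)))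
      (sum_esym_erase_mul_mem_combination 𝕜 i j (by omega))))
    ext q c
    have hH : ∀ a, esymHess 𝕜 (j + 1) c a q =
        if a ∈ univ.erase c then esym ((univ.erase c).erase a) j q else 0 := by
      intro a
      by_cases h : a = c <;> simp [esymHess, h]
    have h1 : (n : 𝕜) - 1 = #((univ : Finset (Fin n)).erase c) := by
      rw [card_erase_of_mem (mem_univ c), Nat.cast_sub (card_pos.2 ⟨c, mem_univ c⟩)]; simp
    have hA := sum_esym_erase (univ : Finset (Fin n)) i q
    have hB := sum_esym_erase ((univ : Finset (Fin n)).erase c) j q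
    have hB' : ∑ b, esymHess 𝕜 (j + 1) c b q = ((n : 𝕜) - 1 - j) * esym (univ.erase c) j q := by
      rw [h1, ← hB]
      simp only [hH, sum_ite_mem, univ_inter]
    have hT : ∑ a ∈ univ.erase c, esym (univ.erase a) i q * esym ((univ.erase c).erase a) j q =
        ∑ a, esym (univ.erase a) i q * esymHess 𝕜 (j + 1) c a q := by
      simp only [hH, mul_ite, mul_zero, sum_ite_mem, univ_inter]
    rw [card_univ, Fintype.card_fin] at hA
    simp only [Pi.smul_apply, Pi.sub_apply, smul_eq_mul, hT]
    rw [mul_mul_mul_comm, ← hA, ← hB', sum_mul_sum, ← sum_sub_distrib, mul_sum]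
    refine sum_congr rfl fun a _ => ?_
    rw [mul_sub, mul_sum, ← add_sum_erase _ _ (mem_univ a), ← add_sum_erase univ (fun b =>
      4 * _) (mem_univ a)]
    simp only [flatCometric, Matrix.of_apply, if_true]
    rw [sum_congr rfl fun b hb => by rw [if_neg (ne_of_mem_erase hb).symm]]
    rw [sum_congr rfl fun b hb => by rw [mul_comm _ (4 : 𝕜), mul_assoc]]
    ring

end Coefficients

/-! ### Partial derivatives and Christoffel symbols in flat coordinates. -/

section Calculus

variable {𝕜 : Type*} [RCLike 𝕜] {n : ℕ}

theorem pd_congr {f g : (Fin n → 𝕜) → 𝕜} {x : Fin n → 𝕜} (h : f =ᶠ[𝓝 x] g) (k : Fin n) :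
    pd k f x = pd k g x := by
  rw [pd, h.fderiv_eq, pd]

theorem pd_mul {f g : (Fin n → 𝕜) → 𝕜} {x : Fin n → 𝕜} (hf : DifferentiableAt 𝕜 f x)
    (hg : DifferentiableAt 𝕜 g x) (k : Fin n) :
    pd k (fun y => f y * g y) x = pd k f x * g x + f x * pd k g x := by
  rw [pd, fderiv_fun_mul hf hg]
  simp [pd]
  ring

theorem pd_sum {ι : Type*} {s : Finset ι} {f : ι → (Fin n → 𝕜) → 𝕜} {x : Fin n → 𝕜}
    (hf : ∀ a ∈ s, DifferentiableAt 𝕜 (f a) x) (k : Fin n) :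
    pd k (fun y => ∑ a ∈ s, f a y) x = ∑ a ∈ s, pd k (f a) x := by
  rw [pd, fderiv_fun_sum hf]
  simp [pd]

theorem pd_const (c : 𝕜) (x : Fin n → 𝕜) (k : Fin n) : pd k (fun _ => c) x = 0 := by
  simp [pd]

theorem pd_comp {f : (Fin n → 𝕜) → 𝕜} {q : (Fin n → 𝕜) → Fin n → 𝕜} {x : Fin n → 𝕜}
    (hf : DifferentiableAt 𝕜 f (q x)) (hq : DifferentiableAt 𝕜 q x) (m : Fin n) :
    pd m (fun y => f (q y)) x = ∑ k, pd k f (q x) * pd m (fun y => q y k) x := by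
  have h := fderiv_comp x hf hq
  have hk : ∀ k, pd m (fun y => q y k) x = fderiv 𝕜 q x (Pi.single m 1) k := by
    intro k
    rw [pd, fderiv_pi (fun i => differentiableAt_pi.1 hq i)]
    rfl
  change fderiv 𝕜 (f ∘ q) x _ = _
  rw [h, ContinuousLinearMap.comp_apply]
  conv_lhs => rw [pi_eq_sum_univ' (fderiv 𝕜 q x (Pi.single m 1))]
  simp only [map_sum, map_smul, smul_eq_mul]
  refine sum_congr rfl fun k _ => ?_
  rw [mul_comm]
  exact congrArg _ (hk k).symm

theorem pd_coord (i m : Fin n) (x : Fin n → 𝕜) :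
    pd m (fun y : Fin n → 𝕜 => y i) x = if i = m then 1 else 0 := by
  have : HasFDerivAt (fun y : Fin n → 𝕜 => y i)
    (ContinuousLinearMap.proj (R := 𝕜) (φ := fun _ : Fin n => 𝕜) i) x := hasFDerivAt_apply i x
  rw [pd, this.fderiv]
  simp [Pi.single_apply]

theorem differentiable_esym (S : Finset (Fin n)) (m : ℕ) :
    Differentiable 𝕜 (fun q : Fin n → 𝕜 => esym S m q) := by
  unfold esym
  fun_prop

/-- As a function of `q k` alone the polynomial is affine, with slope given by `esym_succ`. -/
theorem pd_esym_succ (S : Finset (Fin n)) (m : ℕ) (k : Fin n) (q : Fin n → 𝕜) :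
    pd k (fun q : Fin n → 𝕜 => esym S (m + 1) q) q =
      if k ∈ S then esym (S.erase k) m q else 0 := by
  rw [pd, ← (differentiable_esym S (m + 1) q).lineDeriv_eq_fderiv]
  have hl : ∀ (T : Finset (Fin n)) (r : ℕ), k ∉ T → ∀ t : 𝕜,
      esym T r (q + t • Pi.single k 1) = esym T r q := fun T r hT t =>
    esym_congr fun l hl => by
      have : l ≠ k := fun h => hT (h ▸ hl)
      simp [this]
  rw [lineDeriv]
  split_ifs with hk
  · have : ∀ t : 𝕜, esym S (m + 1) (q + t • Pi.single k 1) =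
        esym S (m + 1) q + t * esym (S.erase k) m q := by
      intro t
      rw [esym_succ hk, esym_succ hk, hl _ _ (notMem_erase k S), hl _ _ (notMem_erase k S)]
      simp
      ring
    simp only [this]
    simp
  · simp only [hl S _ hk]
    simp

theorem pd_esym (j : ℕ) (c b : Fin n) (q : Fin n → 𝕜) :
    pd c (fun q : Fin n → 𝕜 => esym (univ.erase b) j q) q = esymHess 𝕜 j c b q := by
  rw [esymHess_comm]
  rcases j with _ | j
  · simp [pd_const, esymHess]
  · rw [pd_esym_succ]
    by_cases h : c = b <;> simp [esymHess, h]

theorem basicInv_eq (p : Fin n → 𝕜) (i : Fin n) :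
    basicInv p i = esym univ ((i : ℕ) + 1) (fun l => p l ^ 2) := rfl

theorem pd_basicInv (i k : Fin n) (p : Fin n → 𝕜) :
    pd k (fun p => basicInv p i) p =
      esym (univ.erase k) i (fun l => p l ^ 2) * (2 * p k) := by
  have h := pd_comp (f := fun q : Fin n → 𝕜 => esym univ ((i : ℕ) + 1) q)
    (q := fun p l => p l ^ 2) (x := p) (differentiable_esym _ _ _) (by fun_prop) k
  simp only [basicInv_eq]
  rw [h, sum_eq_single k]
  · simp only [pd_esym_succ, mem_univ, if_true, pow_two]
    rw [pd_mul (by fun_prop) (by fun_prop), pd_coord]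
    simp; left; ring
  · intro l _ hl
    simp only [pow_two]
    rw [pd_mul (by fun_prop) (by fun_prop), pd_coord]
    simp [hl]
  · simp

theorem differentiableAt_inv_apply {A : (Fin n → 𝕜) → Matrix (Fin n) (Fin n) 𝕜} {x : Fin n → 𝕜}
    (hA : ∀ i j, DifferentiableAt 𝕜 (fun y => A y i j) x) (hdet : (A x).det ≠ 0) (i j : Fin n) :
    DifferentiableAt 𝕜 (fun y => (A y)⁻¹ i j) x := by
  have hd : ∀ M : (Fin n → 𝕜) → Matrix (Fin n) (Fin n) 𝕜,
      (∀ i j, DifferentiableAt 𝕜 (fun y => M y i j) x) →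
      DifferentiableAt 𝕜 (fun y => (M y).det) x := by
    intro M hM
    simp only [Matrix.det_apply]
    refine DifferentiableAt.fun_sum fun σ _ => ?_
    simp only [Units.smul_def, zsmul_eq_mul]
    refine (differentiableAt_const _).fun_mul ?_
    have hσ : ∀ a, DifferentiableAt 𝕜 (fun y => M y (σ a) a) x := fun a => hM (σ a) a
    fun_prop
  simp only [Matrix.inv_def, Ring.inverse_eq_inv', Matrix.smul_apply, smul_eq_mul,
    Matrix.adjugate_apply]
  refine ((hd A hA).inv hdet).mul (hd _ fun a b => ?_)
  simp only [Matrix.updateRow_apply]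
  split_ifs
  · exact differentiableAt_const _
  · exact hA a b

theorem mul_pd_of_mul_eq_one {x : Fin n → 𝕜} {A B : (Fin n → 𝕜) → Matrix (Fin n) (Fin n) 𝕜}
    (hAB : ∀ᶠ y in 𝓝 x, A y * B y = 1)
    (hA : ∀ i j, DifferentiableAt 𝕜 (fun y => A y i j) x)
    (hB : ∀ i j, DifferentiableAt 𝕜 (fun y => B y i j) x) (m : Fin n) :
    A x * (Matrix.of fun a b => pd m (fun y => B y a b) x) =
      -((Matrix.of fun a b => pd m (fun y => A y a b) x) * B x) := by
  rw [eq_neg_iff_add_eq_zero]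
  ext a b
  have h1 : pd m (fun y => (A y * B y) a b) x = 0 := by
    rw [pd_congr (g := fun _ => (1 : Matrix (Fin n) (Fin n) 𝕜) a b)
      (hAB.mono fun y hy => congrFun (congrFun hy a) b), pd_const]
  have h2 : pd m (fun y => (A y * B y) a b) x = _ :=
    pd_sum (s := univ) (f := fun c y => A y a c * B y c b)
      (fun c _ => (hA a c).fun_mul (hB c b)) m
  rw [h1] at h2
  rw [Matrix.zero_apply, h2, sum_congr rfl fun c _ => pd_mul (hA a c) (hB c b) m,
    sum_add_distrib, add_comm]
  rfl

/-- If the cometric is `A C Aᵀ` with `C` constant and `A⁻¹` a Jacobian matrix, i.e. if the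
metric is constant in suitable coordinates, then the contravariant Christoffel symbols are
`A C (∂_k A)ᵀ`. -/
theorem contraChristoffel_of_flat {h : (Fin n → 𝕜) → Matrix (Fin n) (Fin n) 𝕜} {x : Fin n → 𝕜}
    {A B : (Fin n → 𝕜) → Matrix (Fin n) (Fin n) 𝕜} {C D : Matrix (Fin n) (Fin n) 𝕜}
    (hCD : C * D = 1) (hD : D.transpose = D)
    (hh : ∀ᶠ y in 𝓝 x, h y = A y * C * (A y).transpose)
    (hAB : ∀ᶠ y in 𝓝 x, A y * B y = 1)
    (hA : ∀ i j, DifferentiableAt 𝕜 (fun y => A y i j) x)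
    (hB : ∀ i j, DifferentiableAt 𝕜 (fun y => B y i j) x)
    (hsymm : ∀ k i m, pd m (fun y => B y k i) x = pd i (fun y => B y k m) x) (i j k : Fin n) :
    contraChristoffel h x i j k =
      (A x * C * (Matrix.of fun a b => pd k (fun y => A y a b) x).transpose) i j := by
  have hinv : ∀ᶠ y in 𝓝 x, (h y)⁻¹ = (B y).transpose * D * B y := by
    filter_upwards [hh, hAB] with y h1 h2
    rw [h1]
    refine Matrix.inv_eq_left_inv ?_
    have h3 : (B y).transpose * (A y).transpose = 1 := by
      rw [← Matrix.transpose_mul, h2, Matrix.transpose_one]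
    calc (B y).transpose * D * B y * (A y * C * (A y).transpose)
        = (B y).transpose * (D * ((B y * A y) * C)) * (A y).transpose := by
          simp only [Matrix.mul_assoc]
      _ = 1 := by
          rw [mul_eq_one_comm.1 h2, Matrix.one_mul, mul_eq_one_comm.1 hCD, Matrix.mul_one, h3]
  set dB : Fin n → Matrix (Fin n) (Fin n) 𝕜 :=
    fun m => Matrix.of fun a b => pd m (fun y => B y a b) x with hdB
  set dA : Fin n → Matrix (Fin n) (Fin n) 𝕜 :=
    fun m => Matrix.of fun a b => pd m (fun y => A y a b) x with hdA
  have hdBA : ∀ m, A x * dB m = - (dA m * B x) := mul_pd_of_mul_eq_one hAB hA hB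
  have hg : ∀ a b m, pd m (fun y => (h y)⁻¹ a b) x =
      ((dB m).transpose * D * B x) a b + ((B x).transpose * D * dB m) a b := by
    intro a b m
    rw [pd_congr (hinv.mono fun y hy => by rw [hy])]
    simp only [Matrix.mul_apply, Matrix.transpose_apply]
    rw [pd_sum fun c _ => by fun_prop, ← sum_add_distrib]
    refine sum_congr rfl fun c _ => ?_
    rw [pd_mul (by fun_prop) (by fun_prop), pd_sum fun c _ => by fun_prop]
    congr 2
    refine sum_congr rfl fun d _ => ?_
    rw [pd_mul (by fun_prop) (by fun_prop), pd_const]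
    simp [hdB]
  have hs1 : ∀ a b m, ((B x).transpose * D * dB m) a b = ((B x).transpose * D * dB b) a m := by
    intro a b m
    rw [Matrix.mul_apply, Matrix.mul_apply]
    exact sum_congr rfl fun c _ => congrArg _ (hsymm c b m)
  have hs2 : ∀ a b m, ((dB m).transpose * D * B x) a b = ((B x).transpose * D * dB m) b a := by
    intro a b m
    rw [← Matrix.transpose_apply (_ * _ * _) a b]
    simp only [Matrix.transpose_mul, Matrix.transpose_transpose, hD, Matrix.mul_assoc]
  have hx : h x = A x * C * (A x).transpose := hh.self_of_nhds
  have hABx : A x * B x = 1 := hAB.self_of_nhds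
  have hcov : ∀ a b m, pd m (fun y => (h y)⁻¹ a b) x =
      ((B x).transpose * D * dB m) b a + ((B x).transpose * D * dB m) a b := fun a b m => by
    rw [hg, hs2]
  -- By `hsymm` the three derivatives of the covariant metric combine to 2 Bᵀ D ∂_k B; raising the
  -- index leaves A ∂_k B = -(∂_k A) B.
  have hChr : ∀ l s, christoffel h x l s k = -(dA k * B x) l s := by
    intro l s
    rw [← Matrix.neg_apply, ← hdBA]
    have h2 : ∀ m, pd k (fun y => (h y)⁻¹ s m) x + pd s (fun y => (h y)⁻¹ k m) x
        - pd m (fun y => (h y)⁻¹ s k) x = 2 * ((B x).transpose * D * dB k) m s := by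
      intro m
      rw [hcov, hcov, hcov, hs1 m k s, hs1 k m s, hs1 s m k]
      ring
    simp only [christoffel, h2]
    have h3 : h x * ((B x).transpose * D * dB k) = A x * dB k := by
      have h4 : (A x).transpose * (B x).transpose = 1 := by
        rw [← Matrix.transpose_mul, mul_eq_one_comm.1 hABx, Matrix.transpose_one]
      calc h x * ((B x).transpose * D * dB k)
          = A x * (C * (((A x).transpose * (B x).transpose) * D)) * dB k := by
            rw [hx]; simp only [Matrix.mul_assoc]
        _ = _ := by rw [h4, Matrix.one_mul, hCD, Matrix.mul_one]
    have hhs : ∀ m, h x m l = h x l m := by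
      intro m
      have hC : C.transpose = C := by
        calc C.transpose = C.transpose * (D * C) := by rw [mul_eq_one_comm.1 hCD, Matrix.mul_one]
          _ = (D * C).transpose * C := by rw [Matrix.transpose_mul, hD, Matrix.mul_assoc]
          _ = C := by rw [mul_eq_one_comm.1 hCD, Matrix.transpose_one, Matrix.one_mul]
      rw [← Matrix.transpose_apply (h x) l m, hx]
      simp only [Matrix.transpose_mul, Matrix.transpose_transpose, hC, Matrix.mul_assoc]
    rw [← h3, Matrix.mul_apply, mul_sum]
    refine sum_congr rfl fun m _ => ?_
    rw [hhs]
    ring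
  simp only [contraChristoffel, hChr, mul_neg, sum_neg_distrib, neg_neg]
  have h5 : (B x * A x).transpose = 1 := by
    rw [mul_eq_one_comm.1 hABx, Matrix.transpose_one]
  calc ∑ s, h x i s * (dA k * B x) j s = (h x * (dA k * B x).transpose) i j := by
        rw [Matrix.mul_apply]; rfl
    _ = (A x * C * ((B x * A x).transpose * (dA k).transpose)) i j := by
        rw [hx]; simp only [Matrix.transpose_mul, Matrix.mul_assoc]
    _ = _ := by rw [h5, Matrix.one_mul]

theorem exists_flatCometric_mul_eq_one (hn : 2 ≤ n) :
    ∃ D : Matrix (Fin n) (Fin n) 𝕜, flatCometric 𝕜 n * D = 1 ∧ D.transpose = D := by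
  have h1 : (n : 𝕜) - 1 ≠ 0 := by
    rw [sub_ne_zero]
    exact_mod_cast (by omega : n ≠ 1)
  -- Inverse of 4(J - I), found from J² = nJ.
  refine ⟨Matrix.of fun a b => (1 / 4) * (1 / ((n : 𝕜) - 1) - if a = b then 1 else 0), ?_, ?_⟩
  · ext a b
    have h2 : ∀ c, flatCometric 𝕜 n a c = 4 - if a = c then 4 else 0 := by
      intro c
      by_cases h : a = c <;> simp [flatCometric, h]
    simp only [Matrix.mul_apply, h2, Matrix.of_apply, sub_mul, mul_sub, sum_sub_distrib]
    rw [Matrix.one_apply]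
    by_cases h : a = b <;> (simp [h]; field_simp; try ring)
  · ext a b
    simp [eq_comm]

theorem contraChristoffel_cometricInU (hn : 2 ≤ n) {U : Set (Fin n → 𝕜)}
    {ψ : (Fin n → 𝕜) → Fin n → 𝕜} (hψ : IsLocalInverse U ψ) {x : Fin n → 𝕜} (hx : x ∈ U) :
    ∃ (q : Fin n → 𝕜) (B : Matrix (Fin n) (Fin n) 𝕜),
      (∀ i : Fin n, esym univ ((i : ℕ) + 1) q = x i) ∧
      (Matrix.of fun i a : Fin n => esym (univ.erase a) i q) * B = 1 ∧
      ∀ i j k, contraChristoffel (cometricInU ψ) x i j k = ∑ c, (∑ a, ∑ b,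
        esym (univ.erase a) i q * flatCometric 𝕜 n a b * esymHess 𝕜 j c b q) * B c k := by
  set q : (Fin n → 𝕜) → Fin n → 𝕜 := fun y l => ψ y l ^ 2 with hq
  set A : (Fin n → 𝕜) → Matrix (Fin n) (Fin n) 𝕜 :=
    fun y => Matrix.of fun i a : Fin n => esym (univ.erase a) i (q y) with hA
  set B : (Fin n → 𝕜) → Matrix (Fin n) (Fin n) 𝕜 :=
    fun y => Matrix.of fun l m => pd m (fun z => q z l) y with hB
  have hdψ : ∀ y ∈ U, DifferentiableAt 𝕜 ψ y := fun y hy =>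
    (hψ.differentiableOn y hy).differentiableAt (hψ.isOpen.mem_nhds hy)
  have hdq : ∀ y ∈ U, DifferentiableAt 𝕜 q y := fun y hy => by
    have := hdψ y hy
    exact differentiableAt_pi.2 fun l => (differentiableAt_pi.1 this l).fun_pow 2
  have heq : ∀ y ∈ U, ∀ i : Fin n, esym univ ((i : ℕ) + 1) (q y) = y i := fun y hy i =>
    congrFun (hψ.right_inv y hy) i
  have hAB : ∀ y ∈ U, A y * B y = 1 := by
    intro y hy
    ext i m
    have h1 := pd_comp (f := fun q : Fin n → 𝕜 => esym univ ((i : ℕ) + 1) q)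
      (differentiable_esym _ _ _) (hdq y hy) m
    rw [pd_congr (g := fun z => z i)
      (eventually_of_mem (hψ.isOpen.mem_nhds hy) fun z hz => heq z hz i), pd_coord] at h1
    rw [Matrix.one_apply, h1, Matrix.mul_apply]
    simp only [pd_esym_succ, mem_univ, if_true, hA, hB, Matrix.of_apply]
  -- If p_l = 0, then dq_l = 2 p_l dp_l = 0, so the invertible matrix `B y` would have a zero row.
  have hψ0 : ∀ y ∈ U, ∀ l, ψ y l ≠ 0 := by
    intro y hy l h0
    have h1 : (B y * A y) l l = 1 := by rw [mul_eq_one_comm.1 (hAB y hy), Matrix.one_apply_eq]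
    have h2 : ∀ m, B y l m = 0 := by
      intro m
      have := differentiableAt_pi.1 (hdψ y hy) l
      simp only [hB, hq, Matrix.of_apply, pow_two]
      rw [pd_mul this this, h0]
      ring
    simp [Matrix.mul_apply, h2] at h1
  have hh : ∀ y ∈ U, cometricInU ψ y = A y * flatCometric 𝕜 n * (A y).transpose := by
    intro y hy
    ext i j
    simp only [cometricInU, Matrix.of_apply, pd_basicInv, Matrix.mul_apply, sum_mul,
      Matrix.transpose_apply, hA]
    rw [sum_comm]
    refine sum_congr rfl fun b _ => sum_congr rfl fun a _ => ?_
    have ha := hψ0 y hy a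
    have hb := hψ0 y hy b
    by_cases hab : a = b
    · simp [cometric, flatCometric, hab]
    · simp only [cometric, flatCometric, Matrix.of_apply, hab, if_false, hq]
      field_simp
      ring
  have hAd : ∀ y ∈ U, ∀ i a, DifferentiableAt 𝕜 (fun z => A z i a) y := fun y hy i a => by
    simp only [hA, Matrix.of_apply]
    exact DifferentiableAt.fun_comp' y (g := fun q : Fin n → 𝕜 => esym (univ.erase a) i q)
      (differentiable_esym (univ.erase a) i (q y)) (hdq y hy)
  have hUx := hψ.isOpen.mem_nhds hx
  have hBA : ∀ᶠ y in 𝓝 x, B y = (A y)⁻¹ := eventually_of_mem hUx fun y hy =>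
    (Matrix.inv_eq_right_inv (hAB y hy)).symm
  have hdet : (A x).det ≠ 0 := fun h => by
    have := congrArg Matrix.det (hAB x hx)
    simp [h] at this
  -- `ψ` is only assumed differentiable once; its Jacobian gains regularity from being the inverse
  -- of `A`.
  have hBd : ∀ l m, DifferentiableAt 𝕜 (fun y => B y l m) x := fun l m =>
    (differentiableAt_inv_apply (hAd x hx) hdet l m).congr_of_eventuallyEq
      (hBA.mono fun y hy => congrFun (congrFun hy l) m)
  have hdA : ∀ i a m, pd m (fun y => A y i a) x =
      ∑ c, esymHess 𝕜 i c a (q x) * B x c m := by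
    intro i a m
    have := pd_comp (f := fun q : Fin n → 𝕜 => esym (univ.erase a) i q)
      (differentiable_esym _ _ _) (hdq x hx) m
    simp only [pd_esym] at this
    exact this
  -- Symmetry of the second derivatives of q is read off from ∂B = -B (∂A) B and the symmetry of the
  -- Hessians of the e_j.
  have hsymm : ∀ l i m, pd m (fun y => B y l i) x = pd i (fun y => B y l m) x := by
    have hdB : ∀ l i m, pd m (fun y => B y l i) x =
        -∑ a, B x l a * ∑ b, (∑ c, esymHess 𝕜 a c b (q x) * B x c m) * B x b i := by
      intro l i m
      have h1 := congrArg (B x * ·)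
        (mul_pd_of_mul_eq_one (eventually_of_mem hUx hAB) (hAd x hx) hBd m)
      simp only [← Matrix.mul_assoc, mul_eq_one_comm.1 (hAB x hx), Matrix.one_mul,
        Matrix.mul_neg] at h1
      have h2 := congrFun (congrFun h1 l) i
      rw [Matrix.neg_apply, Matrix.mul_assoc, Matrix.mul_apply] at h2
      simp only [Matrix.mul_apply, Matrix.of_apply, hdA] at h2
      exact h2
    intro l i m
    rw [hdB, hdB]
    congr 1
    refine sum_congr rfl fun a _ => congrArg _ ?_
    simp only [sum_mul]
    rw [sum_comm]
    refine sum_congr rfl fun b _ => sum_congr rfl fun c _ => ?_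
    rw [esymHess_comm]
    ring
  obtain ⟨D, hCD, hD⟩ := exists_flatCometric_mul_eq_one (𝕜 := 𝕜) hn
  refine ⟨q x, B x, heq x hx, hAB x hx, fun i j k => ?_⟩
  rw [contraChristoffel_of_flat hCD hD (eventually_of_mem hUx hh) (eventually_of_mem hUx hAB)
    (hAd x hx) hBd hsymm]
  rw [Matrix.mul_apply]
  simp only [Matrix.transpose_apply, Matrix.of_apply, hdA, Matrix.mul_apply, mul_sum, sum_mul]
  rw [sum_comm]
  refine sum_congr rfl fun c _ => ?_
  rw [sum_comm]
  refine sum_congr rfl fun a _ => sum_congr rfl fun b _ => ?_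
  simp only [hA, Matrix.of_apply]
  ring

end Calculus

end OrbitB

theorem mainTheorem4 (𝕜 : Type*) [RCLike 𝕜] (n : ℕ) (hn : 2 ≤ n) :
    ∃ P : Fin n → Fin n → Fin n → MvPolynomial (Fin n) 𝕜,
      (∀ (U : Set (Fin n → 𝕜)) (ψ : (Fin n → 𝕜) → (Fin n → 𝕜)),
        OrbitB.IsLocalInverse U ψ → ∀ x ∈ U, ∀ i j k : Fin n,
          OrbitB.contraChristoffel (OrbitB.cometricInU ψ) x i j k
            = MvPolynomial.eval x (P i j k)) ∧
      (∀ i j k : Fin n,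
        MvPolynomial.weightedTotalDegree (fun a : Fin n => 2 * ((a : ℕ) + 1)) (P i j k)
          < 4 * n - 4) ∧
      (∀ i j k : Fin n,
        MvPolynomial.degreeOf (⟨n - 2, by omega⟩ : Fin n) (P i j k) ≤ 1) := by
  choose P hP hF using fun i j => OrbitB.contraction_mem_combination 𝕜 hn i j
  refine ⟨P, fun U ψ hψ x hx i j k => ?_, fun i j k => ?_, fun i j k => ?_⟩
  · obtain ⟨q, B, hq, hB, h⟩ := OrbitB.contraChristoffel_cometricInU hn hψ hx
    have hq' : (fun i : Fin n => OrbitB.esym Finset.univ ((i : ℕ) + 1) q) = x := funext hq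
    have hF' := hF i j q
    rw [hq'] at hF'
    -- Pairing du_l with ∂q/∂u_k gives δ_{lk}, which isolates the coefficient `P i j k`.
    have hl : ∀ l : Fin n, ∑ c, OrbitB.esym (Finset.univ.erase c) l q * B c k =
        (1 : Matrix (Fin n) (Fin n) 𝕜) l k := by
      intro l
      rw [← hB, Matrix.mul_apply]
      rfl
    simp only [h, hF', Finset.sum_mul]
    rw [Finset.sum_comm]
    simp only [mul_assoc, ← Finset.mul_sum, hl]
    simp [Matrix.one_apply]
  -- The supremum over an empty support is 0, so the strict bound also needs 0 < 4n - 4.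
  · rw [MvPolynomial.weightedTotalDegree, Finset.sup_lt_iff (by simp; omega)]
    exact fun d hd => (hP i j k hd).1
  · rw [MvPolynomial.degreeOf_le_iff]
    exact fun d hd => (hP i j k hd).2 _
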